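/- Let $N, J\ge 1$ be integers, let $\tau>0$, let $I_X:\mathbb{C}^{2N-1}\to\mathbb{C}^{J}$ be a linear operator (interpolating from an equally spaced grid of $2N-1$ points to a set $X$ of $J$ sample points), let $f\in\mathbb{C}^{J}$, and let $\mu_1,\dots,\mu_J>0$ be weights; $\mu$ also denotes the operator of pointwise multiplication by $(\mu_j)$. Let $\mathbb{M}_{N,N}$ be the space of complex $N\times N$ matrices with the Frobenius inner product, and let $\Lambda:\mathbb{C}^{2N-1}\to\mathbb{M}_{N,N}$, $(\Lambda a)_{j,k}=a_{j+k}$ ($0\le j,k\le N-1$), with range $\mathcal{H}$, the space of Hankel matrices. Let $\mathcal{P}_{\mathcal{H}}$ and $\mathcal{P}_{\mathcal{H}^\perp}$ be the orthogonal projections onto $\mathcal{H}$ and $\mathcal{H}^\perp$. Let $\beta_l$ be the number of pairs $(j,k)$ with $j+k=l$, and let $\frac1\beta$ (or $\beta^{-1}$) denote pointwise multiplication by $(1/\beta_l)_l$. Put $$T=\Lambda\beta^{-1}I_X^*\,\mu\, I_X\beta^{-1}\Lambda^*.$$ This is a self-adjoint operator; operator inequalities involving $T$ are understood on $\mathcal{H}$,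 in the sense of quadratic forms ($T>I$ means $\langle TA,A\rangle>\|A\|^2$ for all $0\neq A\in\mathcal{H}$), and $I$ is the identity on $\mathcal{H}$. For $\sigma_0(A)\ge\dots\ge\sigma_{N-1}(A)$ the singular values of $A\in\mathbb{M}_{N,N}$, set $$\mathcal{R}_\tau(A)=\sum_{j}\Big(\tau^2-\max(\tau-\sigma_j(A),0)^2\Big),$$ and for a real function $s$ on $[0,\infty)$ with $s(0)=0$ set $\mathfrak{S}_s(A)=U\,\mathrm{diag}(s(\sigma_j(A)))\,V^*$, where $A=U\,\mathrm{diag}(\sigma_j(A))\,V^*$ is a singular value decomposition. For $q>1$ let $s_{\tau,q}(\sigma)=\max(\min(\sigma,\tau),\sigma/q)$. Let $$F=\Lambda\Big(\tfrac1\beta I_X^*\big(\tfrac{\mu f}{q}\big)\Big),\qquad \mathsf{U}(F,A)=F+A-\Lambda\Big(\tfrac{1}{q\beta}I_X^*\big(\mu I_X(\tfrac1\beta\Lambda^*A)\big)\Big),$$ and define $(W',A')=\mathfrak{B}_{\mathrm{us}}(W,A)$ on $\mathbb{M}_{N,N}\times\mathbb{M}_{N,N}$ by $$W'=\mathfrak{S}_{s_{\tau,q}}\big(q\,\mathsf{U}(F,A)+\mathcal{P}_{\mathcal{H}^\perp}(W)\big),\qquad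 A'=\tfrac1{q-1}\big(q\,\mathsf{U}(F,A)-\mathcal{P}_{\mathcal{H}}(W')\big).$$ Finally, let $$\Phi(a)=\mathcal{R}_\tau(\Lambda a)+\sum_{j=1}^{J}\mu_j\,|(I_Xa-f)_j|^2,\qquad a\in\mathbb{C}^{2N-1}.$$ A point $a$ is called stationary for $\Phi$ if $0$ belongs to the (regular) subdifferential of $\Phi$ at $a$, i.e. $\Phi(b)\ge\Phi(a)-o(\|b-a\|)$ as $b\to a$. 1. Let $q>1$ satisfy $T\le qI$. Then for every $A^\circ\in\mathbb{M}_{N,N}$, there exists $W^\circ\in\mathbb{M}_{N,N}$ such that $(W^\circ,A^\circ)$ is a fixed point of $\mathfrak{B}_{\mathrm{us}}$ if and only if $A^\circ=\Lambda a^\circ$ for some stationary point $a^\circ$ of $\Phi$. 2. If $T\ge I$, then $\Phi$ is convex on $\mathbb{C}^{2N-1}$ (as a real vector space). 3. If $T>I$, then $\Phi$ is strictly convex. -/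

import Mathlib

open Filter Topology
open scoped Matrix

/-! ### Singular values and the singular value functional calculus -/

section SingularValues

variable {N : ℕ}

/-- The singular values `σ₀(A) ≥ σ₁(A) ≥ … ≥ σ_{N-1}(A) ≥ 0` of a square complex matrix. -/
noncomputable def singVal (A : Matrix (Fin N) (Fin N) ℂ) (j : Fin N) : ℝ :=
  (Matrix.toEuclideanLin A).singularValues j

/-- `A = U diag(σ) V*` is a singular value decomposition of `A`: `U`, `V` are unitary and the
entries of `σ` are nonnegative. -/
structure IsSVD (A U V : Matrix (Fin N) (Fin N) ℂ) (σ : Fin N → ℝ) : Prop where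
  left_unitary : U ∈ Matrix.unitaryGroup (Fin N) ℂ
  right_unitary : V ∈ Matrix.unitaryGroup (Fin N) ℂ
  nonneg : ∀ j, 0 ≤ σ j
  eq : A = U * Matrix.diagonal (fun j => (σ j : ℂ)) * Vᴴ

/-- Every square matrix has a singular value decomposition. -/
theorem exists_isSVD (A : Matrix (Fin N) (Fin N) ℂ) :
    ∃ UV : Matrix (Fin N) (Fin N) ℂ × Matrix (Fin N) (Fin N) ℂ,
      IsSVD A UV.1 UV.2 (singVal A) := by
  classical
  set T := Matrix.toEuclideanLin A with hT
  have hn : Module.finrank ℂ (EuclideanSpace ℂ (Fin N)) = N := by simp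
  set v := T.isSymmetric_adjoint_comp_self.eigenvectorBasis hn with hv
  have hσ : ∀ j, 0 ≤ singVal A j := fun j => T.singularValues_nonneg _
  have hin : ∀ i j, inner ℂ (T (v i)) (T (v j)) = if i = j then ((singVal A j : ℂ)) ^ 2 else 0 := by
    intro i j
    have h1 : (LinearMap.adjoint T ∘ₗ T) (v j) = ((singVal A j : ℂ) ^ 2) • v j := by
      rw [hv, LinearMap.IsSymmetric.apply_eigenvectorBasis, ← T.sq_singularValues_fin hn j]
      simp [singVal, hT]
    rw [← LinearMap.adjoint_inner_right]
    change inner ℂ (v i) ((LinearMap.adjoint T ∘ₗ T) (v j)) = _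
    rw [h1, inner_smul_right, orthonormal_iff_ite.mp v.orthonormal]
    simp
  let s : Set (Fin N) := {i | singVal A i ≠ 0}
  let u : Fin N → EuclideanSpace ℂ (Fin N) := fun i => ((singVal A i : ℂ)⁻¹) • T (v i)
  have hu : Orthonormal ℂ (s.domRestrict u) := by
    rw [orthonormal_iff_ite]
    rintro ⟨i, hi⟩ ⟨j, hj⟩
    have hi' : (singVal A i : ℂ) ≠ 0 := by exact_mod_cast hi
    change inner ℂ (u i) (u j) = _
    simp only [u, inner_smul_left, inner_smul_right, hin, Subtype.mk.injEq]
    split_ifs with h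
    · subst h
      simp only [map_inv₀, Complex.conj_ofReal]
      field_simp
    · simp
  obtain ⟨b, hb⟩ := Orthonormal.exists_orthonormalBasis_extension_of_card_eq (by simp) hu
  have hTv : ∀ i, T (v i) = (singVal A i : ℂ) • b i := by
    intro i
    by_cases hi : singVal A i = 0
    · have : inner ℂ (T (v i)) (T (v i)) = 0 := by rw [hin]; simp [hi]
      rw [inner_self_eq_zero.mp this, hi]; simp
    · have hi' : (singVal A i : ℂ) ≠ 0 := by exact_mod_cast hi
      rw [hb i hi]
      simp only [u, smul_smul, mul_inv_cancel₀ hi', one_smul]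
  let e := EuclideanSpace.basisFun (Fin N) ℂ
  let U : Matrix (Fin N) (Fin N) ℂ := e.toBasis.toMatrix b
  let V : Matrix (Fin N) (Fin N) ℂ := e.toBasis.toMatrix v
  have hV : V ∈ Matrix.unitaryGroup (Fin N) ℂ := e.toMatrix_orthonormalBasis_mem_unitary v
  have hU : U ∈ Matrix.unitaryGroup (Fin N) ℂ := e.toMatrix_orthonormalBasis_mem_unitary b
  refine ⟨(U, V), hU, hV, hσ, ?_⟩
  have hAV : A * V = U * Matrix.diagonal (fun j => (singVal A j : ℂ)) := by
    ext i j
    have h := congrArg (fun x : EuclideanSpace ℂ (Fin N) => x i) (hTv j)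
    simp only [Matrix.mul_diagonal]
    have e1 : (A * V) i j = (T (v j)) i := by
      simp [hT, Matrix.toLpLin_apply, Matrix.mul_apply, Matrix.mulVec, dotProduct, V, e,
        Module.Basis.toMatrix_apply]
    rw [e1, h]
    simp [U, e, Module.Basis.toMatrix_apply, mul_comm]
  have hVV : V * Vᴴ = 1 := Matrix.mem_unitaryGroup_iff.mp hV
  calc A = A * (V * Vᴴ) := by rw [hVV, mul_one]
    _ = _ := by rw [← mul_assoc, hAV]

/-- The singular value functional calculus: `𝔖_f(A) = U diag(f(σ_j(A))) V*`, where
`A = U diag(σ_j(A)) V*` is a singular value decomposition of `A`. -/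
noncomputable def svCalc (f : ℝ → ℝ) (A : Matrix (Fin N) (Fin N) ℂ) : Matrix (Fin N) (Fin N) ℂ :=
  (exists_isSVD A).choose.1 * Matrix.diagonal (fun j => (f (singVal A j) : ℂ)) *
    (exists_isSVD A).choose.2ᴴ

/-- If `f 0 = 0`, then `svCalc f A` may be computed from any singular value decomposition
of `A`. -/
theorem svCalc_eq_of_isSVD {f : ℝ → ℝ} (hf : f 0 = 0) {A U V : Matrix (Fin N) (Fin N) ℂ}
    {σ : Fin N → ℝ} (h : IsSVD A U V σ) :
    svCalc f A = U * Matrix.diagonal (fun j => (f (σ j) : ℂ)) * Vᴴ := by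
  have h' := (exists_isSVD A).choose_spec
  unfold svCalc
  generalize (exists_isSVD A).choose.1 = U' at h'
  generalize (exists_isSVD A).choose.2 = V' at h'
  generalize singVal A = σ' at h'
  have hU1 : Uᴴ * U = 1 := Matrix.mem_unitaryGroup_iff'.mp h.left_unitary
  have hV1 : Vᴴ * V = 1 := Matrix.mem_unitaryGroup_iff'.mp h.right_unitary
  have hV2 : V * Vᴴ = 1 := Matrix.mem_unitaryGroup_iff.mp h.right_unitary
  have hU1' : U'ᴴ * U' = 1 := Matrix.mem_unitaryGroup_iff'.mp h'.left_unitary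
  have hU2' : U' * U'ᴴ = 1 := Matrix.mem_unitaryGroup_iff.mp h'.left_unitary
  have hV1' : V'ᴴ * V' = 1 := Matrix.mem_unitaryGroup_iff'.mp h'.right_unitary
  set D := fun g : Fin N → ℝ => Matrix.diagonal (fun j => (g j : ℂ)) with hD
  have hDH : ∀ g, (D g)ᴴ = D g := by
    intro g
    simp only [hD, Matrix.diagonal_conjTranspose]
    congr 1; ext j; simp
  have hE : U * D σ * Vᴴ = U' * D σ' * V'ᴴ := h.eq.symm.trans h'.eq
  have hE2 : V * D σ * Uᴴ = V' * D σ' * U'ᴴ := by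
    have := congrArg Matrix.conjTranspose hE
    simpa [Matrix.conjTranspose_mul, hDH, mul_assoc] using this
  have k1 : (U'ᴴ * U) * D σ = D σ' * (V'ᴴ * V) := by
    calc (U'ᴴ * U) * D σ = U'ᴴ * (U * D σ * Vᴴ) * V := by
          simp only [mul_assoc, hV1, mul_one]
      _ = (U'ᴴ * U') * D σ' * (V'ᴴ * V) := by rw [hE]; simp only [mul_assoc]
      _ = _ := by rw [hU1', one_mul]
  have k2 : (V'ᴴ * V) * D σ = D σ' * (U'ᴴ * U) := by
    calc (V'ᴴ * V) * D σ = V'ᴴ * (V * D σ * Uᴴ) * U := by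
          simp only [mul_assoc, hU1, mul_one]
      _ = (V'ᴴ * V') * D σ' * (U'ᴴ * U) := by rw [hE2]; simp only [mul_assoc]
      _ = _ := by rw [hV1', one_mul]
  have k3 : (U'ᴴ * U) * D (fun j => f (σ j)) = D (fun j => f (σ' j)) * (V'ᴴ * V) := by
    ext i j
    have e1 := congrFun (congrFun k1 i) j
    have e2 := congrFun (congrFun k2 i) j
    simp only [hD, Matrix.mul_diagonal, Matrix.diagonal_mul] at e1 e2 ⊢
    generalize (U'ᴴ * U) i j = Q at *
    generalize (V'ᴴ * V) i j = P at *
    have p1 := h.nonneg j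
    have p2 := h'.nonneg i
    by_cases hs : σ j = σ' i
    · by_cases h0 : σ j = 0
      · rw [← hs, h0, hf]; simp
      · have h0' : (σ j : ℂ) ≠ 0 := by exact_mod_cast h0
        have : Q = P := by
          rw [← hs, mul_comm] at e1
          exact mul_left_cancel₀ h0' e1
        rw [this, hs, mul_comm]
    · have d1 : ((σ j - σ' i : ℝ) : ℂ) ≠ 0 := by
        exact_mod_cast sub_ne_zero.mpr hs
      have d2 : ((σ j + σ' i : ℝ) : ℂ) ≠ 0 := by
        have : σ j + σ' i ≠ 0 := fun hc => hs (by linarith)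
        exact_mod_cast this
      have q1 : ((σ j - σ' i : ℝ) : ℂ) * (Q + P) = 0 := by
        push_cast; linear_combination e1 + e2
      have q2 : ((σ j + σ' i : ℝ) : ℂ) * (Q - P) = 0 := by
        push_cast; linear_combination e1 - e2
      have r1 := (mul_eq_zero.mp q1).resolve_left d1
      have r2 := (mul_eq_zero.mp q2).resolve_left d2
      have hQ : Q = 0 := by linear_combination (r1 + r2) / 2
      have hP : P = 0 := by linear_combination (r1 - r2) / 2
      simp [hQ, hP]
  calc U' * D (fun j => f (σ' j)) * V'ᴴ
      = U' * (D (fun j => f (σ' j)) * (V'ᴴ * V)) * Vᴴ := by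
        simp only [mul_assoc, hV2, mul_one]
    _ = (U' * U'ᴴ) * U * D (fun j => f (σ j)) * Vᴴ := by rw [← k3]; simp only [mul_assoc]
    _ = _ := by rw [hU2', one_mul]

/-- `s_{τ,q}(σ) = max (min(σ, τ), σ / q)`. -/
noncomputable def sFun (τ q σ : ℝ) : ℝ := max (min σ τ) (σ / q)

/-- `𝓡_τ(A) = ∑_j (τ² - max(τ - σ_j(A), 0)²)`. -/
noncomputable def rankReg (τ : ℝ) (A : Matrix (Fin N) (Fin N) ℂ) : ℝ :=
  ∑ j : Fin N, (τ ^ 2 - (max (τ - singVal A j) 0) ^ 2)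

end SingularValues

/-! ### The Euclidean spaces and Hankel matrices -/

/-- Complex `N × N` matrices as a Euclidean space: the norm and the inner product are the
Frobenius ones. -/
abbrev MatSpace (N : ℕ) : Type := EuclideanSpace ℂ (Fin N × Fin N)

/-- Sequences of length `2N - 1`. -/
abbrev SeqSpace (N : ℕ) : Type := EuclideanSpace ℂ (Fin (2 * N - 1))

/-- An element of `MatSpace N` viewed as a matrix. -/
def MatSpace.toMat {N : ℕ} (A : MatSpace N) : Matrix (Fin N) (Fin N) ℂ :=
  Matrix.of fun j k => A (j, k)

/-- A matrix viewed as an element of `MatSpace N`. -/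
def MatSpace.ofMat {N : ℕ} (A : Matrix (Fin N) (Fin N) ℂ) : MatSpace N :=
  WithLp.toLp 2 fun p => A p.1 p.2

/-- The anti-diagonal `j + k` on which the entry `(j, k)` lies (zero-based indices). -/
def antidiagIdx {N : ℕ} (p : Fin N × Fin N) : Fin (2 * N - 1) :=
  ⟨p.1 + p.2, by have := p.1.isLt; have := p.2.isLt; omega⟩

/-- The Hankel operator `Λ : ℂ^{2N-1} → 𝕄_{N,N}`, `(Λ a)_{j,k} = a_{j+k}`. -/
noncomputable def hankel (N : ℕ) : SeqSpace N →ₗ[ℂ] MatSpace N where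
  toFun a := WithLp.toLp 2 fun p => a (antidiagIdx p)
  map_add' _ _ := rfl
  map_smul' _ _ := rfl

/-- The space `𝓗` of Hankel matrices. -/
noncomputable def hankelSpace (N : ℕ) : Submodule ℂ (MatSpace N) := LinearMap.range (hankel N)

/-- `β_l` is the number of entries on the `l`-th anti-diagonal. -/
def antidiagCount (N : ℕ) (l : Fin (2 * N - 1)) : ℕ :=
  (Finset.univ.filter fun p : Fin N × Fin N => antidiagIdx p = l).card

/-- Pointwise multiplication of a sequence by a real sequence of weights. -/
noncomputable def mulWeight {ι : Type*} [Fintype ι] (w : ι → ℝ) :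
    EuclideanSpace ℂ ι →ₗ[ℂ] EuclideanSpace ℂ ι where
  toFun a := WithLp.toLp 2 fun i => (w i : ℂ) * a i
  map_add' a b := by ext i; simp [mul_add]
  map_smul' c a := by ext i; simp [mul_left_comm]

/-- `(1/β) Λ*`. -/
noncomputable def hankelInv (N : ℕ) : MatSpace N →ₗ[ℂ] SeqSpace N :=
  mulWeight (fun l => ((antidiagCount N l : ℝ))⁻¹) ∘ₗ LinearMap.adjoint (hankel N)

/-! ### The fixed point operator and the objective functional -/

section Unequal

variable {N J : ℕ}

/-- The operator `Λ β⁻¹ I_X* μ I_X β⁻¹ Λ*`. -/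
noncomputable def usOperator (IX : SeqSpace N →ₗ[ℂ] EuclideanSpace ℂ (Fin J)) (μ : Fin J → ℝ) :
    MatSpace N →ₗ[ℂ] MatSpace N :=
  hankel N ∘ₗ mulWeight (fun l => ((antidiagCount N l : ℝ))⁻¹) ∘ₗ LinearMap.adjoint IX ∘ₗ
    mulWeight μ ∘ₗ IX ∘ₗ hankelInv N

/-- `F = Λ ((1/β) I_X* (μ f / q))`. -/
noncomputable def usData (IX : SeqSpace N →ₗ[ℂ] EuclideanSpace ℂ (Fin J)) (μ : Fin J → ℝ)
    (f : EuclideanSpace ℂ (Fin J)) (q : ℝ) : MatSpace N :=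
  hankel N (mulWeight (fun l => ((antidiagCount N l : ℝ))⁻¹)
    (LinearMap.adjoint IX (mulWeight (fun j => μ j / q) f)))

/-- `U(F, A) = F + A - Λ ((1/(qβ)) I_X* (μ I_X ((1/β) Λ* A)))`. -/
noncomputable def usU (IX : SeqSpace N →ₗ[ℂ] EuclideanSpace ℂ (Fin J)) (μ : Fin J → ℝ)
    (q : ℝ) (F A : MatSpace N) : MatSpace N :=
  F + A - hankel N (mulWeight (fun l => (q * (antidiagCount N l : ℝ))⁻¹)
    (LinearMap.adjoint IX (mulWeight μ (IX (hankelInv N A)))))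

/-- The map `(W', A') = 𝔅_us (W, A)`,
`W' = 𝔖_{s_{τ,q}} (q U(F, A) + P_{𝓗^⊥} W)`, `A' = (q U(F, A) - P_𝓗 W') / (q - 1)`. -/
noncomputable def usMap (IX : SeqSpace N →ₗ[ℂ] EuclideanSpace ℂ (Fin J)) (μ : Fin J → ℝ)
    (f : EuclideanSpace ℂ (Fin J)) (τ q : ℝ) (p : MatSpace N × MatSpace N) :
    MatSpace N × MatSpace N :=
  let U := usU IX μ q (usData IX μ f q) p.2
  let W' := MatSpace.ofMat (svCalc (sFun τ q)
    ((q : ℂ) • U + (hankelSpace N)ᗮ.starProjection p.1).toMat)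
  (W', ((q : ℂ) - 1)⁻¹ • ((q : ℂ) • U - (hankelSpace N).starProjection W'))

/-- The objective functional `𝓡_τ(Λ a) + ∑_j μ_j |(I_X a - f)_j|²`. -/
noncomputable def usObjective (IX : SeqSpace N →ₗ[ℂ] EuclideanSpace ℂ (Fin J)) (μ : Fin J → ℝ)
    (f : EuclideanSpace ℂ (Fin J)) (τ : ℝ) (a : SeqSpace N) : ℝ :=
  rankReg τ (hankel N a).toMat + ∑ j : Fin J, μ j * ‖(IX a - f) j‖ ^ 2

end Unequal

/-- The (regular, or Fréchet) subdifferential of `Φ` at `x`: the set of real-linear functionals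
`g` with `Φ y ≥ Φ x + g (y - x) - o(‖y - x‖)` as `y → x`. It is the singleton of the derivative
where `Φ` is differentiable, and the usual convex subdifferential if `Φ` is convex. -/
def frechetSubdifferential {E : Type*} [NormedAddCommGroup E] [NormedSpace ℝ E] (Φ : E → ℝ)
    (x : E) : Set (E →L[ℝ] ℝ) :=
  {g | ∀ ε > 0, ∀ᶠ y in 𝓝 x, Φ x + g (y - x) - ε * ‖y - x‖ ≤ Φ y}

/-- `x` is a stationary point of the (possibly non-smooth) functional `Φ`: zero belongs to the
subdifferential of `Φ` at `x`. -/
def IsStationaryPoint {E : Type*} [NormedAddCommGroup E] [NormedSpace ℝ E] (Φ : E → ℝ)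
    (x : E) : Prop :=
  (0 : E →L[ℝ] ℝ) ∈ frechetSubdifferential Φ x

/-! Adding `‖A‖²` to `𝓡_τ(A)` gives `2G(A)` with `G` convex (`matEnv`). On a scalar singular value,
`G` is `τσ` up to `τ` and `(τ² + σ²)/2` beyond. A Fenchel-Young trace inequality
(`re_trace_le_of_isSVD`) transfers scalar subgradients to matrices.

Hence `Φ(a) = 2G(Λa) +` a quadratic polynomial with leading form `⟨TΛa, Λa⟩ - ‖Λa‖²`
(`usObjective_sub`). If `T ≥ I` or `T > I`, this form is nonnegative or positive definite, which
gives convexity or strict convexity.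

For general `T`, `Φ` is still a convex function plus a smooth one. Stationarity therefore says that
minus the smooth gradient is a subgradient of `G` restricted to `𝓗`. By Hahn-Banach, such a
subgradient is `P_𝓗 W` for some `W ∈ ∂G(Λa)`.

On the algorithmic side, `s_{τ,q}` sends `z` to the `s` in the unique splitting `z = s + (q-1)σ`
with `s ∈ ∂G(σ)`. Thus `W = 𝔖(W + (q-1)A)` means `W ∈ ∂G(A)` (`eq_svCalc_iff_isSubgradient`), and
the second fixed point equation prescribes `P_𝓗 W`. The two conditions coincide. -/

/-! ### The scalar envelope and its conjugate -/

/-- Half of `τ² - max(τ - σ, 0)² + σ²`, a convex function of `σ ≥ 0`. -/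
noncomputable def envFun (τ σ : ℝ) : ℝ := (τ ^ 2 - (max (τ - σ) 0) ^ 2 + σ ^ 2) / 2

/-- The convex conjugate of `envFun τ` (extended evenly), restricted to `y ≥ 0`. -/
noncomputable def envConj (τ y : ℝ) : ℝ := ((max y τ) ^ 2 - τ ^ 2) / 2

theorem mul_le_envFun_add_envConj {τ σ y : ℝ} (hσ : 0 ≤ σ) :
    σ * y ≤ envFun τ σ + envConj τ y := by
  unfold envFun envConj
  rcases le_total (τ - σ) 0 with h1 | h1 <;> rcases le_total y τ with h2 | h2
  · rw [max_eq_right h1, max_eq_right h2]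
    nlinarith [mul_nonneg hσ (sub_nonneg.mpr h2), sq_nonneg (σ - τ)]
  · rw [max_eq_right h1, max_eq_left h2]
    nlinarith [sq_nonneg (σ - y)]
  · rw [max_eq_left h1, max_eq_right h2]
    nlinarith [mul_nonneg hσ (sub_nonneg.mpr h2)]
  · rw [max_eq_left h1, max_eq_left h2]
    nlinarith [mul_nonneg h1 (sub_nonneg.mpr h2), sq_nonneg (y - τ)]

/-- Equality in Fenchel-Young: `max σ τ` is a subgradient of the envelope at `σ`, which at `σ = 0`
is the extreme one, `τ`. -/
theorem envFun_add_envConj_max (τ σ : ℝ) :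
    envFun τ σ + envConj τ (max σ τ) = σ * max σ τ := by
  unfold envFun envConj
  rcases le_total σ τ with h | h
  · rw [max_eq_left (sub_nonneg.mpr h), max_eq_right h, max_self]; ring
  · rw [max_eq_right (sub_nonpos.mpr h), max_eq_left h, max_eq_left h]; ring

/-! ### The thresholding function as a subgradient selection -/

section sFun

variable {τ q z : ℝ}

theorem sFun_zero (hτ : 0 ≤ τ) : sFun τ q 0 = 0 := by simp [sFun, hτ]

theorem sFun_nonneg (hq : 1 < q) (hz : 0 ≤ z) : 0 ≤ sFun τ q z :=
  le_max_of_le_right (div_nonneg hz (by linarith))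

theorem sFun_le (hq : 1 < q) (hz : 0 ≤ z) : sFun τ q z ≤ z :=
  max_le (min_le_left _ _) (div_le_self hz hq.le)

/-- The three regimes of `s` give `σ = 0` for `z ≤ τ`, `0 ≤ σ ≤ τ` with `s = τ` for `τ ≤ z ≤ qτ`,
and `σ = s = z/q` beyond. In each, `s` lies in the subdifferential at `σ`. -/
theorem envFun_add_envConj_sFun (hq : 1 < q) (hz : 0 ≤ z) :
    envFun τ ((z - sFun τ q z) / (q - 1)) + envConj τ (sFun τ q z) =
      (z - sFun τ q z) / (q - 1) * sFun τ q z := by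
  have hq0 : 0 < q := by linarith
  have hq1 : 0 < q - 1 := by linarith
  have hzq : z / q ≤ z := div_le_self hz hq.le
  unfold envFun envConj
  rcases le_total z τ with h1 | h1
  · have hs : sFun τ q z = z := by rw [sFun, min_eq_left h1, max_eq_left hzq]
    rw [hs, sub_self, zero_div, max_eq_right h1, sub_zero, zero_mul]
    rcases le_total τ 0 with h | h
    · have : z = 0 := by linarith
      have : τ = 0 := by linarith
      subst this; simp
    · rw [max_eq_left h]; ring
  rcases le_total (z / q) τ with h2 | h2
  · have hs : sFun τ q z = τ := by rw [sFun, min_eq_right h1, max_eq_left h2]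
    have h3 : (z - τ) / (q - 1) ≤ τ := by
      rw [div_le_iff₀ hq0] at h2
      rw [div_le_iff₀ hq1]; linarith
    rw [hs, max_self, max_eq_left (sub_nonneg.mpr h3)]; ring
  · have hs : sFun τ q z = z / q := by rw [sFun, min_eq_right h1, max_eq_right h2]
    have h3 : (z - z / q) / (q - 1) = z / q := by field_simp
    rw [hs, h3, max_eq_right (sub_nonpos.mpr h2), max_eq_left h2]; ring

end sFun

/-! ### Traces and singular value decompositions -/

section Trace

variable {N : ℕ}

theorem sum_normSq_row_of_mem_unitaryGroup {P : Matrix (Fin N) (Fin N) ℂ}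
    (hP : P ∈ Matrix.unitaryGroup (Fin N) ℂ) (j : Fin N) : ∑ k, Complex.normSq (P j k) = 1 := by
  have h := congrFun (congrFun (Matrix.mem_unitaryGroup_iff.mp hP) j) j
  simp only [Matrix.star_eq_conjTranspose, Matrix.mul_apply, Matrix.conjTranspose_apply,
    Complex.star_def, Complex.mul_conj, Matrix.one_apply_eq] at h
  exact_mod_cast h

theorem sum_normSq_col_of_mem_unitaryGroup {P : Matrix (Fin N) (Fin N) ℂ}
    (hP : P ∈ Matrix.unitaryGroup (Fin N) ℂ) (k : Fin N) : ∑ j, Complex.normSq (P j k) = 1 := by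
  have h := congrFun (congrFun (Matrix.mem_unitaryGroup_iff'.mp hP) k) k
  simp only [Matrix.star_eq_conjTranspose, Matrix.mul_apply, Matrix.conjTranspose_apply,
    Complex.star_def, ← Complex.normSq_eq_conj_mul_self, Matrix.one_apply_eq] at h
  exact_mod_cast h

theorem conjTranspose_diagonal_ofReal (g : Fin N → ℝ) :
    (Matrix.diagonal (fun j => (g j : ℂ)))ᴴ = Matrix.diagonal (fun j => (g j : ℂ)) := by
  rw [Matrix.diagonal_conjTranspose]; congr 1; ext j; simp

/-- Cyclicity of the trace leaves only the transition matrices `UᴴU'` and `VᴴV'` between the two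
pairs of bases. -/
theorem trace_conjTranspose_mul_isSVD {A B U V U' V' : Matrix (Fin N) (Fin N) ℂ}
    {σ w : Fin N → ℝ} (hA : IsSVD A U V σ) (hB : IsSVD B U' V' w) :
    (Aᴴ * B).trace =
      ∑ j, ∑ k, ((σ j * w k : ℝ) : ℂ) * ((Uᴴ * U') j k * star ((Vᴴ * V') j k)) := by
  set D := Matrix.diagonal (fun j => (σ j : ℂ)) with hD
  set D' := Matrix.diagonal (fun j => (w j : ℂ)) with hD'
  have h1 : (Aᴴ * B).trace = (D * (Uᴴ * U') * D' * (Vᴴ * V')ᴴ).trace := by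
    rw [hA.eq, hB.eq]
    simp only [Matrix.conjTranspose_mul, Matrix.conjTranspose_conjTranspose, hD,
      conjTranspose_diagonal_ofReal]
    rw [Matrix.mul_assoc V, Matrix.trace_mul_comm V]
    simp only [Matrix.mul_assoc, hD']
  rw [h1, Matrix.trace]
  refine Finset.sum_congr rfl fun j _ => ?_
  rw [Matrix.diag_apply, Matrix.mul_apply]
  refine Finset.sum_congr rfl fun k _ => ?_
  rw [hD, hD', Matrix.mul_diagonal, Matrix.diagonal_mul, Matrix.conjTranspose_apply]
  push_cast; ring

theorem re_mul_star_le (x y : ℂ) :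
    (x * star y).re ≤ (Complex.normSq x + Complex.normSq y) / 2 := by
  simp only [Complex.star_def, Complex.mul_re, Complex.conj_re, Complex.conj_im,
    Complex.normSq_apply]
  nlinarith [sq_nonneg (x.re - y.re), sq_nonneg (x.im - y.im)]

/-- A trace inequality: if `x y ≤ φ(x) + ψ(y)` at the singular values, then
`Re ⟪A, B⟫ ≤ ∑ φ(σ_j(A)) + ∑ ψ(σ_j(B))`. -/
theorem re_trace_le_of_isSVD {A B U V U' V' : Matrix (Fin N) (Fin N) ℂ}
    {σ w : Fin N → ℝ} (hA : IsSVD A U V σ) (hB : IsSVD B U' V' w) {φ ψ : ℝ → ℝ}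
    (h : ∀ j k, σ j * w k ≤ φ (σ j) + ψ (w k)) :
    (Aᴴ * B).trace.re ≤ ∑ j, φ (σ j) + ∑ k, ψ (w k) := by
  have hP : Uᴴ * U' ∈ Matrix.unitaryGroup (Fin N) ℂ :=
    mul_mem (Unitary.star_mem hA.left_unitary) hB.left_unitary
  have hQ : Vᴴ * V' ∈ Matrix.unitaryGroup (Fin N) ℂ :=
    mul_mem (Unitary.star_mem hA.right_unitary) hB.right_unitary
  rw [trace_conjTranspose_mul_isSVD hA hB]
  set P := Uᴴ * U'
  set Q := Vᴴ * V'
  -- `M` is doubly stochastic and dominates `Re (P_{jk} conj Q_{jk})`. Averaging the scalar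
  -- inequality against `M` thus separates the two sums, with no ordering of the singular values.
  set M : Fin N → Fin N → ℝ := fun j k => (Complex.normSq (P j k) + Complex.normSq (Q j k)) / 2
    with hM
  have hM0 : ∀ j k, 0 ≤ M j k := fun j k =>
    div_nonneg (add_nonneg (Complex.normSq_nonneg _) (Complex.normSq_nonneg _)) two_pos.le
  have hrow : ∀ j, ∑ k, M j k = 1 := fun j => by
    rw [← Finset.sum_div, Finset.sum_add_distrib, sum_normSq_row_of_mem_unitaryGroup hP,
      sum_normSq_row_of_mem_unitaryGroup hQ]; norm_num
  have hcol : ∀ k, ∑ j, M j k = 1 := fun k => by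
    rw [← Finset.sum_div, Finset.sum_add_distrib, sum_normSq_col_of_mem_unitaryGroup hP,
      sum_normSq_col_of_mem_unitaryGroup hQ]; norm_num
  calc (∑ j, ∑ k, ((σ j * w k : ℝ) : ℂ) * (P j k * star (Q j k))).re
      = ∑ j, ∑ k, (σ j * w k) * (P j k * star (Q j k)).re := by
        simp only [Complex.re_sum, Complex.re_ofReal_mul]
    _ ≤ ∑ j, ∑ k, (φ (σ j) * M j k + ψ (w k) * M j k) := by
        refine Finset.sum_le_sum fun j _ => Finset.sum_le_sum fun k _ => ?_
        calc (σ j * w k) * (P j k * star (Q j k)).re ≤ (σ j * w k) * M j k :=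
              mul_le_mul_of_nonneg_left (re_mul_star_le _ _)
                (mul_nonneg (hA.nonneg j) (hB.nonneg k))
          _ ≤ (φ (σ j) + ψ (w k)) * M j k := mul_le_mul_of_nonneg_right (h j k) (hM0 j k)
          _ = _ := add_mul _ _ _
    _ = ∑ j, φ (σ j) * ∑ k, M j k + ∑ k, ψ (w k) * ∑ j, M j k := by
        simp only [Finset.sum_add_distrib, Finset.mul_sum]
        congr 1
        exact Finset.sum_comm
    _ = _ := by simp only [hrow, hcol, mul_one]

theorem trace_conjTranspose_mul_of_isSVD_of_isSVD {A B U V : Matrix (Fin N) (Fin N) ℂ}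
    {σ w : Fin N → ℝ} (hA : IsSVD A U V σ) (hB : IsSVD B U V w) :
    (Aᴴ * B).trace = ((∑ j, σ j * w j : ℝ) : ℂ) := by
  rw [trace_conjTranspose_mul_isSVD hA hB]
  have h1 : Uᴴ * U = 1 := Matrix.mem_unitaryGroup_iff'.mp hA.left_unitary
  have h2 : Vᴴ * V = 1 := Matrix.mem_unitaryGroup_iff'.mp hA.right_unitary
  rw [h1, h2]
  push_cast
  refine Finset.sum_congr rfl fun j _ => ?_
  rw [Finset.sum_eq_single j] <;> simp +contextual [eq_comm]

end Trace

/-! ### The envelope of the rank regularizer -/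

section MatEnv

variable {N : ℕ} {τ q : ℝ}

/-- `W` is a subgradient of `G` at `A`. -/
def IsSubgradient (G : MatSpace N → ℝ) (A W : MatSpace N) : Prop :=
  ∀ B, G A + (inner ℂ W (B - A)).re ≤ G B

/-- `(𝓡_τ(A) + ‖A‖²) / 2`, as a sum over the singular values. -/
noncomputable def matEnv (τ : ℝ) (A : MatSpace N) : ℝ := ∑ j, envFun τ (singVal A.toMat j)

theorem inner_eq_trace (A B : MatSpace N) : inner ℂ A B = (A.toMatᴴ * B.toMat).trace := by
  rw [PiLp.inner_apply, Fintype.sum_prod_type, Finset.sum_comm, Matrix.trace]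
  refine Finset.sum_congr rfl fun j _ => ?_
  rw [Matrix.diag_apply, Matrix.mul_apply]
  refine Finset.sum_congr rfl fun k _ => ?_
  simp [MatSpace.toMat, mul_comm]

theorem exists_isSVD_toMat (A : MatSpace N) : ∃ U V, IsSVD A.toMat U V (singVal A.toMat) :=
  let ⟨UV, h⟩ := exists_isSVD A.toMat
  ⟨UV.1, UV.2, h⟩

/-- Fenchel-Young for matrices. An arbitrary decomposition of `W` is allowed because subgradients
are built with unsorted singular values. -/
theorem re_inner_le_matEnv_add {A W : MatSpace N} {U V : Matrix (Fin N) (Fin N) ℂ}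
    {w : Fin N → ℝ} (hW : IsSVD W.toMat U V w) :
    (inner ℂ W A).re ≤ matEnv τ A + ∑ k, envConj τ (w k) := by
  obtain ⟨U', V', hA⟩ := exists_isSVD_toMat A
  rw [← inner_conj_symm, Complex.conj_re, inner_eq_trace]
  exact re_trace_le_of_isSVD hA hW fun j k => mul_le_envFun_add_envConj (hA.nonneg j)

/-- Matrices with a simultaneous singular value decomposition whose singular values are pairs in
the subdifferential of the scalar envelope. -/
theorem isSubgradient_matEnv_of_isSVD {A W : MatSpace N} {U V : Matrix (Fin N) (Fin N) ℂ}
    {σ w : Fin N → ℝ} (hA : IsSVD A.toMat U V σ) (hW : IsSVD W.toMat U V w)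
    (h : ∀ j, envFun τ (σ j) + envConj τ (w j) = σ j * w j) :
    IsSubgradient (matEnv τ) A W := by
  have h1 : (inner ℂ W A).re = ∑ j, envFun τ (σ j) + ∑ j, envConj τ (w j) := by
    rw [inner_eq_trace, trace_conjTranspose_mul_of_isSVD_of_isSVD hW hA, Complex.ofReal_re,
      ← Finset.sum_add_distrib]
    exact Finset.sum_congr rfl fun j _ => by rw [h, mul_comm]
  -- The list `σ` need not be the ordered one. Pairing `A` with a matrix `W'` that attains Fenchel
  -- equality for the ordered list compares the two sums without uniqueness of singular values.
  have h2 : matEnv τ A ≤ ∑ j, envFun τ (σ j) := by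
    obtain ⟨U', V', hA'⟩ := exists_isSVD_toMat A
    set w' : Fin N → ℝ := fun j => max (singVal A.toMat j) τ
    set W' : MatSpace N := MatSpace.ofMat (U' * Matrix.diagonal (fun j => (w' j : ℂ)) * V'ᴴ)
    have hW' : IsSVD W'.toMat U' V' w' :=
      ⟨hA'.left_unitary, hA'.right_unitary, fun j => le_max_of_le_left (hA'.nonneg j), rfl⟩
    have e1 : (inner ℂ A W').re = matEnv τ A + ∑ j, envConj τ (w' j) := by
      rw [inner_eq_trace, trace_conjTranspose_mul_of_isSVD_of_isSVD hA' hW', Complex.ofReal_re,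
        matEnv, ← Finset.sum_add_distrib]
      exact Finset.sum_congr rfl fun j _ => (envFun_add_envConj_max _ _).symm
    have e2 : (inner ℂ A W').re ≤ ∑ j, envFun τ (σ j) + ∑ j, envConj τ (w' j) := by
      rw [inner_eq_trace]
      exact re_trace_le_of_isSVD hA hW' fun j k => mul_le_envFun_add_envConj (hA.nonneg j)
    linarith
  intro B
  have h3 := re_inner_le_matEnv_add (τ := τ) (A := B) hW
  rw [inner_sub_right, Complex.sub_re]
  linarith

theorem exists_isSubgradient_matEnv (τ : ℝ) (A : MatSpace N) :
    ∃ W, IsSubgradient (matEnv τ) A W := by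
  obtain ⟨U, V, hA⟩ := exists_isSVD_toMat A
  refine ⟨MatSpace.ofMat
    (U * Matrix.diagonal (fun j => ((max (singVal A.toMat j) τ : ℝ) : ℂ)) * Vᴴ),
    isSubgradient_matEnv_of_isSVD hA (w := fun j => max (singVal A.toMat j) τ)
      ⟨hA.left_unitary, hA.right_unitary, fun j => le_max_of_le_left (hA.nonneg j), rfl⟩
      fun j => envFun_add_envConj_max _ _⟩

theorem two_mul_matEnv (τ : ℝ) (A : MatSpace N) :
    2 * matEnv τ A = rankReg τ A.toMat + ‖A‖ ^ 2 := by
  obtain ⟨U, V, hA⟩ := exists_isSVD_toMat A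
  have h : ‖A‖ ^ 2 = ∑ j, singVal A.toMat j ^ 2 := by
    rw [← inner_self_eq_norm_sq (𝕜 := ℂ), inner_eq_trace,
      trace_conjTranspose_mul_of_isSVD_of_isSVD hA hA]
    simp [sq]
  rw [h, rankReg, matEnv, Finset.mul_sum, ← Finset.sum_add_distrib]
  exact Finset.sum_congr rfl fun j _ => by rw [envFun]; ring

/-- Monotonicity of the subdifferential: `Re ⟪W - W', A - A'⟫ ≥ 0`, whereas equal sums make it `-c‖A
- A'‖²`. -/
theorem IsSubgradient.eq_and_eq_of_add_smul_eq {G : MatSpace N → ℝ} {A W A' W' : MatSpace N}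
    (h : IsSubgradient G A W) (h' : IsSubgradient G A' W') {c : ℝ} (hc : 0 < c)
    (hZ : W + (c : ℂ) • A = W' + (c : ℂ) • A') : A = A' ∧ W = W' := by
  have e : W - W' = -((c : ℂ) • (A - A')) := by
    rw [smul_sub, neg_sub, sub_eq_sub_iff_add_eq_add, hZ, add_comm]
  have h1 := h A'
  have h2 := h' A
  have h3 : (inner ℂ (W - W') (A - A')).re = -(c * ‖A - A'‖ ^ 2) := by
    rw [e, inner_neg_left, inner_smul_left, Complex.conj_ofReal, Complex.neg_re,
      Complex.re_ofReal_mul, ← inner_self_eq_norm_sq (𝕜 := ℂ)]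
    rfl
  have h4 : (inner ℂ (W - W') (A - A')).re =
      -(inner ℂ W (A' - A)).re - (inner ℂ W' (A - A')).re := by
    rw [← neg_sub A A', inner_neg_right, inner_sub_left, Complex.sub_re, Complex.neg_re, neg_neg]
  have h5 : c * ‖A - A'‖ ^ 2 ≤ 0 := by linarith
  have h6 : ‖A - A'‖ ^ 2 = 0 :=
    le_antisymm (nonpos_of_mul_nonpos_right h5 hc) (sq_nonneg _)
  have h7 : A = A' := sub_eq_zero.mp (norm_eq_zero.mp (pow_eq_zero_iff two_ne_zero |>.mp h6))
  subst h7
  exact ⟨rfl, add_right_cancel hZ⟩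

/-- The scalar splitting `z = s(z) + (q-1)σ`, performed in the singular bases of `Z`, splits `Z`
itself. -/
theorem isSubgradient_matEnv_svCalc (hτ : 0 ≤ τ) (hq : 1 < q) (Z : MatSpace N) :
    IsSubgradient (matEnv τ)
      (((q - 1 : ℝ) : ℂ)⁻¹ • (Z - MatSpace.ofMat (svCalc (sFun τ q) Z.toMat)))
      (MatSpace.ofMat (svCalc (sFun τ q) Z.toMat)) := by
  obtain ⟨U, V, hZ⟩ := exists_isSVD_toMat Z
  have hq1 : 0 < q - 1 := by linarith
  rw [svCalc_eq_of_isSVD (sFun_zero hτ) hZ]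
  set z := singVal Z.toMat
  refine isSubgradient_matEnv_of_isSVD (U := U) (V := V)
    (σ := fun j => (z j - sFun τ q (z j)) / (q - 1)) (w := fun j => sFun τ q (z j))
    ⟨hZ.left_unitary, hZ.right_unitary,
      fun j => div_nonneg (sub_nonneg.mpr (sFun_le hq (hZ.nonneg j))) hq1.le, ?_⟩
    ⟨hZ.left_unitary, hZ.right_unitary, fun j => sFun_nonneg hq (hZ.nonneg j), rfl⟩
    fun j => envFun_add_envConj_sFun hq (hZ.nonneg j)
  have e1 : Matrix.diagonal (fun j => (((z j - sFun τ q (z j)) / (q - 1) : ℝ) : ℂ)) =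
      ((q - 1 : ℝ) : ℂ)⁻¹ • (Matrix.diagonal (fun j => (z j : ℂ)) -
        Matrix.diagonal (fun j => (sFun τ q (z j) : ℂ))) := by
    rw [Matrix.diagonal_sub, ← Matrix.diagonal_smul]
    congr 1; ext j
    simp [div_eq_inv_mul]
  have e2 : ∀ M : Matrix (Fin N) (Fin N) ℂ, ∀ c : ℂ,
      (c • (Z - MatSpace.ofMat M)).toMat = c • (Z.toMat - M) := fun M c => by
    ext i j; simp [MatSpace.toMat, MatSpace.ofMat]
  rw [e2, e1, Matrix.mul_smul, Matrix.smul_mul, Matrix.mul_sub, Matrix.sub_mul, ← hZ.eq]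

/-- The singular value thresholding `𝔖_{s_{τ,q}}` characterizes the subgradients of the
envelope. -/
theorem eq_svCalc_iff_isSubgradient (hτ : 0 ≤ τ) (hq : 1 < q) (A W : MatSpace N) :
    MatSpace.ofMat (svCalc (sFun τ q) (W + ((q - 1 : ℝ) : ℂ) • A).toMat) = W ↔
      IsSubgradient (matEnv τ) A W := by
  have hq1 : 0 < q - 1 := by linarith
  have hc : ((q - 1 : ℝ) : ℂ) ≠ 0 := by exact_mod_cast hq1.ne'
  set Z := W + ((q - 1 : ℝ) : ℂ) • A with hZ
  have key := isSubgradient_matEnv_svCalc hτ hq Z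
  constructor
  · intro h
    rw [h, hZ, add_sub_cancel_left, inv_smul_smul₀ hc] at key
    exact key
  · intro h
    refine (key.eq_and_eq_of_add_smul_eq h hq1 ?_).2
    rw [smul_inv_smul₀ hc, ← hZ]; abel

end MatEnv

/-! ### Convex functions and linear minorants -/

section Convex

variable {E : Type*} [AddCommGroup E] [Module ℝ E]

theorem convexOn_univ_of_exists_linear_le {f : E → ℝ}
    (h : ∀ x, ∃ g : E →ₗ[ℝ] ℝ, ∀ y, f x + g (y - x) ≤ f y) : ConvexOn ℝ Set.univ f := by
  refine ⟨convex_univ, fun x _ y _ a b ha hb hab => ?_⟩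
  obtain ⟨g, hg⟩ := h (a • x + b • y)
  have h1 := mul_le_mul_of_nonneg_left (hg x) ha
  have h2 := mul_le_mul_of_nonneg_left (hg y) hb
  have h3 : a * g (x - (a • x + b • y)) + b * g (y - (a • x + b • y)) = 0 := by
    simp only [map_sub, map_add, map_smul, smul_eq_mul]
    linear_combination (-(a * g x + b * g y)) * hab
  simp only [smul_eq_mul]
  linear_combination h1 + h2 - h3 - f (a • x + b • y) * hab

theorem strictConvexOn_univ_of_exists_linear_lt {f : E → ℝ}
    (h : ∀ x, ∃ g : E →ₗ[ℝ] ℝ, ∀ y, y ≠ x → f x + g (y - x) < f y) :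
    StrictConvexOn ℝ Set.univ f := by
  refine ⟨convex_univ, fun x _ y _ hxy a b ha hb hab => ?_⟩
  obtain ⟨g, hg⟩ := h (a • x + b • y)
  have hx : x ≠ a • x + b • y := fun hc => hxy <| by
    have : b • (x - y) = 0 := by
      rw [smul_sub, sub_eq_zero, ← add_right_inj (a • x), ← hc, ← add_smul, hab, one_smul]
    exact sub_eq_zero.mp ((smul_eq_zero.mp this).resolve_left hb.ne')
  have hy : y ≠ a • x + b • y := fun hc => hxy <| by
    have : a • (x - y) = 0 := by
      rw [smul_sub, sub_eq_zero, ← add_left_inj (b • y), ← hc, ← add_smul, hab, one_smul]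
    exact sub_eq_zero.mp ((smul_eq_zero.mp this).resolve_left ha.ne')
  have h1 := mul_lt_mul_of_pos_left (hg x hx) ha
  have h2 := mul_lt_mul_of_pos_left (hg y hy) hb
  have h3 : a * g (x - (a • x + b • y)) + b * g (y - (a • x + b • y)) = 0 := by
    simp only [map_sub, map_add, map_smul, smul_eq_mul]
    linear_combination (-(a * g x + b * g y)) * hab
  simp only [smul_eq_mul]
  linear_combination h1 + h2 - h3 - f (a • x + b • y) * hab

/-- The Hahn-Banach theorem with a convex majorant vanishing at the origin. -/
theorem exists_extension_of_le_convex {f : E → ℝ} (hf : ConvexOn ℝ Set.univ f) (h0 : f 0 = 0)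
    (p : Submodule ℝ E) (φ : p →ₗ[ℝ] ℝ) (hφ : ∀ x : p, φ x ≤ f x) :
    ∃ g : E →ₗ[ℝ] ℝ, (∀ x : p, g x = φ x) ∧ ∀ x, g x ≤ f x := by
  have hf2 := hf.2
  -- The directional derivative of `f` at the origin: a sublinear function below `f` that still
  -- dominates `φ`, so the sublinear Hahn-Banach theorem applies.
  set N : E → ℝ := fun x => ⨅ t : Set.Ioi (0 : ℝ), (t : ℝ)⁻¹ * f ((t : ℝ) • x) with hN
  have hlow : ∀ x, ∀ t : Set.Ioi (0 : ℝ), -f (-x) ≤ (t : ℝ)⁻¹ * f ((t : ℝ) • x) := by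
    rintro x ⟨t, ht⟩
    have ht : 0 < t := ht
    have h := hf2 (Set.mem_univ (t • x)) (Set.mem_univ (-x)) (a := 1 / (1 + t)) (b := t / (1 + t))
      (by positivity) (by positivity) (by field_simp)
    -- Convexity across the origin bounds the quotients below, so the infimum is finite.
    have e : (1 / (1 + t)) • t • x + (t / (1 + t)) • (-x) = 0 := by
      rw [smul_smul, smul_neg, ← sub_eq_add_neg, ← sub_smul]; ring_nf; simp
    rw [e, h0, smul_eq_mul, smul_eq_mul] at h
    have h' : 0 ≤ f (t • x) + t * f (-x) := by
      have := mul_le_mul_of_nonneg_left h (by positivity : 0 ≤ 1 + t)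
      field_simp at this; linarith
    change -f (-x) ≤ t⁻¹ * f (t • x)
    rw [← div_eq_inv_mul, le_div_iff₀ ht]; linarith
  have hbdd : ∀ x, BddBelow (Set.range fun t : Set.Ioi (0 : ℝ) => (t : ℝ)⁻¹ * f ((t : ℝ) • x)) :=
    fun x => ⟨_, Set.forall_mem_range.mpr (hlow x)⟩
  have : Nonempty (Set.Ioi (0 : ℝ)) := ⟨⟨1, Set.mem_Ioi.mpr one_pos⟩⟩
  have hle : ∀ x (t : ℝ), 0 < t → N x ≤ t⁻¹ * f (t • x) := fun x t ht =>
    ciInf_le (hbdd x) ⟨t, ht⟩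
  have hhom' : ∀ c : ℝ, 0 < c → ∀ x, N (c • x) ≤ c * N x := fun c hc x => by
    rw [← div_le_iff₀' hc]
    refine le_ciInf fun ⟨t, ht⟩ => ?_
    have ht : 0 < t := ht
    have h := hle (c • x) (t / c) (by positivity)
    rw [smul_smul, div_mul_cancel₀ _ hc.ne'] at h
    rw [div_le_iff₀' hc]
    refine h.trans (le_of_eq ?_)
    field_simp
  have hhom : ∀ c : ℝ, 0 < c → ∀ x, N (c • x) = c * N x := fun c hc x => by
    refine le_antisymm (hhom' c hc x) ?_
    have h := hhom' c⁻¹ (inv_pos.mpr hc) (c • x)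
    rw [inv_smul_smul₀ hc.ne'] at h
    calc c * N x ≤ c * (c⁻¹ * N (c • x)) := mul_le_mul_of_nonneg_left h hc.le
      _ = _ := mul_inv_cancel_left₀ hc.ne' _
  have hadd : ∀ x y, N (x + y) ≤ N x + N y := fun x y => by
    refine le_ciInf_add_ciInf ?_
    rintro ⟨s, hs⟩ ⟨t, ht⟩
    have hs : 0 < s := hs
    have ht : 0 < t := ht
    -- With this scale, `(st/(s+t))(x + y)` is a convex combination of `s x` and `t y`.
    have h := hle (x + y) (s * t / (s + t)) (by positivity)
    have hc := hf2 (Set.mem_univ (s • x)) (Set.mem_univ (t • y)) (a := t / (s + t))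
      (b := s / (s + t)) (by positivity) (by positivity) (by field_simp; ring)
    have e : (t / (s + t)) • s • x + (s / (s + t)) • t • y = (s * t / (s + t)) • (x + y) := by
      rw [smul_smul, smul_smul, smul_add]; congr 2 <;> ring
    rw [e, smul_eq_mul, smul_eq_mul] at hc
    refine h.trans ((mul_le_mul_of_nonneg_left hc (by positivity)).trans (le_of_eq ?_))
    change _ = s⁻¹ * f (s • x) + t⁻¹ * f (t • y)
    field_simp
  obtain ⟨g, hg1, hg2⟩ := exists_extension_of_le_sublinear ⟨p, φ⟩ N hhom hadd (fun x => by
    refine le_ciInf fun ⟨t, ht⟩ => ?_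
    have ht : 0 < t := ht
    change φ x ≤ t⁻¹ * f (t • (x : E))
    rw [← div_eq_inv_mul, le_div_iff₀' ht]
    simpa using hφ (t • x))
  refine ⟨g, hg1, fun x => (hg2 x).trans ?_⟩
  simpa using hle x 1 one_pos

end Convex

/-! ### Stationary points of a convex function plus a quadratic perturbation -/

section Stationary

variable {E : Type*} [NormedAddCommGroup E] [NormedSpace ℝ E]

/-- If `Φ` differs from a convex function `C` by an affine function with slope `L` up to a
quadratic error, then `x` is stationary for `Φ` iff `-L` is a subgradient of `C` at `x`. -/
theorem isStationaryPoint_iff_of_convexOn {Φ C : E → ℝ} (hC : ConvexOn ℝ Set.univ C) {x : E}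
    (L : E →ₗ[ℝ] ℝ) {K : ℝ}
    (h : ∀ y, |Φ y - Φ x - (C y - C x) - L (y - x)| ≤ K * ‖y - x‖ ^ 2) :
    IsStationaryPoint Φ x ↔ ∀ y, C x - L (y - x) ≤ C y := by
  unfold IsStationaryPoint frechetSubdifferential
  simp only [Set.mem_ofPred_eq, zero_apply, add_zero]
  constructor
  · intro hs y
    have hC2 := hC.2
    set v := y - x with hv
    -- On the segment from `x` to `y`, convexity makes the increment of `C` at most linear in `t`,
    -- while the error is `O(t²)`. Divide by `t` and let `t → 0⁺`.
    have hlim : ∀ ε > 0, -(ε * ‖v‖) ≤ C y - C x + L v := fun ε hε => by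
      have hline : Tendsto (fun t : ℝ => x + t • v) (𝓝[>] 0) (𝓝 x) := by
        have : Continuous fun t : ℝ => x + t • v := by fun_prop
        simpa using (this.tendsto 0).mono_left nhdsWithin_le_nhds
      have hev : ∀ᶠ t : ℝ in 𝓝[>] 0, -(ε * ‖v‖) - K * t * ‖v‖ ^ 2 ≤ C y - C x + L v := by
        have h1 : Set.Ioo (0 : ℝ) 1 ∈ 𝓝[>] (0 : ℝ) := Ioo_mem_nhdsGT one_pos
        filter_upwards [hline.eventually (hs ε hε), h1] with t ht ⟨ht0, ht1⟩
        have hb := (abs_le.mp (h (x + t • v))).2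
        have hc := hC2 (Set.mem_univ x) (Set.mem_univ y) (a := 1 - t) (b := t)
          (by linarith) ht0.le (by ring)
        have e : (1 - t) • x + t • y = x + t • v := by rw [hv]; module
        rw [e, smul_eq_mul, smul_eq_mul] at hc
        rw [add_sub_cancel_left, norm_smul, Real.norm_of_nonneg ht0.le] at ht hb
        rw [map_smul, smul_eq_mul] at hb
        refine le_of_mul_le_mul_left ?_ ht0
        nlinarith
      have hl : Tendsto (fun t : ℝ => -(ε * ‖v‖) - K * t * ‖v‖ ^ 2) (𝓝[>] 0)
          (𝓝 (-(ε * ‖v‖))) := by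
        have : Continuous fun t : ℝ => -(ε * ‖v‖) - K * t * ‖v‖ ^ 2 := by fun_prop
        simpa using (this.tendsto 0).mono_left nhdsWithin_le_nhds
      exact le_of_tendsto hl hev
    have hl : Tendsto (fun ε : ℝ => -(ε * ‖v‖)) (𝓝[>] 0) (𝓝 0) := by
      have : Continuous fun ε : ℝ => -(ε * ‖v‖) := by fun_prop
      simpa using (this.tendsto 0).mono_left nhdsWithin_le_nhds
    have := le_of_tendsto hl (eventually_mem_nhdsWithin.mono hlim)
    linarith
  · intro hs ε hε
    -- Near `x` the quadratic error is absorbed by `ε‖y - x‖`.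
    have hl : Tendsto (fun y => K * ‖y - x‖) (𝓝 x) (𝓝 0) := by
      have : Continuous fun y => K * ‖y - x‖ := by fun_prop
      simpa using this.tendsto x
    filter_upwards [hl.eventually (gt_mem_nhds hε)] with y hy
    have h1 := (abs_le.mp (h y)).1
    have h2 := hs y
    have h3 := mul_le_mul_of_nonneg_right hy.le (norm_nonneg (y - x))
    nlinarith

end Stationary

/-! ### Subgradients of a restriction -/

section Restriction

variable {N : ℕ}

/-- The real-linear functional `B ↦ Re ⟪W, B⟫`. -/
noncomputable def reInner {E : Type*} [NormedAddCommGroup E] [InnerProductSpace ℂ E] (W : E) :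
    E →ₗ[ℝ] ℝ where
  toFun B := (inner ℂ W B).re
  map_add' A B := by rw [inner_add_right, Complex.add_re]
  map_smul' c B := by
    rw [RCLike.real_smul_eq_coe_smul (K := ℂ), inner_smul_right]
    exact Complex.re_ofReal_mul _ _

/-- A real functional is the real part of a complex one, to which Riesz representation applies. -/
theorem exists_eq_reInner (g : MatSpace N →ₗ[ℝ] ℝ) :
    ∃ W : MatSpace N, ∀ B, (inner ℂ W B).re = g B := by
  let G : MatSpace N →ₗ[ℂ] ℂ := Module.Dual.extendRCLike (𝕜 := ℂ) g
  refine ⟨(InnerProductSpace.toDual ℂ (MatSpace N)).symm G.toContinuousLinearMap, fun B => ?_⟩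
  rw [InnerProductSpace.toDual_symm_apply]
  exact Module.Dual.re_extendRCLike_apply (𝕜 := ℂ) g B

theorem convexOn_of_exists_isSubgradient {G : MatSpace N → ℝ}
    (hG : ∀ A, ∃ W, IsSubgradient G A W) : ConvexOn ℝ Set.univ G :=
  convexOn_univ_of_exists_linear_le fun A => (hG A).imp' reInner fun _ h => h

/-- A subgradient of the restriction of a convex function to a subspace `H` is the orthogonal
projection of a subgradient of the function. -/
theorem exists_isSubgradient_starProjection_eq {G : MatSpace N → ℝ}
    (hG : ConvexOn ℝ Set.univ G) (H : Submodule ℂ (MatSpace N)) {A V : MatSpace N}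
    (hA : A ∈ H) (hV : V ∈ H) (h : ∀ B ∈ H, G A + (inner ℂ V (B - A)).re ≤ G B) :
    ∃ W, IsSubgradient G A W ∧ H.starProjection W = V := by
  have hconv : ConvexOn ℝ Set.univ (fun x => G (A + x) - G A) := by
    have := (hG.translate_right A).add_const (-G A)
    simpa [Function.comp_def, sub_eq_add_neg, Pi.add_def] using this
  obtain ⟨g, hg1, hg2⟩ := exists_extension_of_le_convex hconv (by simp)
    (H.restrictScalars ℝ) ((reInner V).domRestrict _) (by
      rintro ⟨x, hx⟩
      have := h (A + x) (H.add_mem hA hx)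
      rw [add_sub_cancel_left] at this
      change (inner ℂ V x).re ≤ G (A + x) - G A
      linarith)
  obtain ⟨W, hW⟩ := exists_eq_reInner g
  refine ⟨W, fun B => ?_, ?_⟩
  · have := hg2 (B - A)
    rw [add_sub_cancel] at this
    rw [hW]; linarith
  · have hre : ∀ x ∈ H, (inner ℂ (W - V) x).re = 0 := fun x hx => by
      rw [inner_sub_left, Complex.sub_re, hW, sub_eq_zero]
      exact hg1 ⟨x, hx⟩
    refine Submodule.eq_starProjection_of_mem_orthogonal hV
      ((Submodule.mem_orthogonal' _ _).mpr fun x hx => Complex.ext (hre x hx) ?_) |>.symm ▸ rfl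
    -- `H` is a complex subspace, so testing with `i x` also kills the imaginary part.
    have := hre (Complex.I • x) (H.smul_mem _ hx)
    rw [inner_smul_right, Complex.I_mul_re, neg_eq_zero] at this
    exact this

end Restriction

/-! ### The Hankel operator -/

section Hankel

variable {N : ℕ}

theorem antidiagCount_pos (l : Fin (2 * N - 1)) : 0 < antidiagCount N l := by
  have hl := l.isLt
  refine Finset.card_pos.mpr ?_
  -- Since `l ≤ 2N - 2`, what remains after removing `min l (N - 1)` is at most `N - 1`.
  refine ⟨(⟨min (l : ℕ) (N - 1), by omega⟩, ⟨(l : ℕ) - min (l : ℕ) (N - 1), by omega⟩), ?_⟩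
  rw [Finset.mem_filter]
  refine ⟨Finset.mem_univ _, Fin.ext ?_⟩
  simp only [antidiagIdx]
  omega

/-- Each entry is repeated `β_l` times, i.e. `Λ*Λ = β`. Hence `β⁻¹Λ*` is a left inverse of `Λ`. -/
theorem inner_hankel_hankel (a b : SeqSpace N) :
    inner ℂ (hankel N a) (hankel N b) =
      inner ℂ (mulWeight (fun l => (antidiagCount N l : ℝ)) a) b := by
  simp only [PiLp.inner_apply]
  change ∑ p, inner ℂ (a (antidiagIdx p)) (b (antidiagIdx p)) = _
  rw [← Finset.sum_fiberwise Finset.univ (antidiagIdx (N := N))]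
  refine Finset.sum_congr rfl fun l _ => ?_
  rw [Finset.sum_congr rfl (g := fun _ => inner ℂ (a l) (b l)) fun p hp => by
    rw [(Finset.mem_filter.mp hp).2]]
  rw [Finset.sum_const, nsmul_eq_mul]
  simp [mulWeight, antidiagCount]
  ring

theorem mulWeight_mulWeight_inv {ι : Type*} [Fintype ι] {w : ι → ℝ} (hw : ∀ i, w i ≠ 0)
    (a : EuclideanSpace ℂ ι) : mulWeight w (mulWeight (fun i => (w i)⁻¹) a) = a := by
  ext i
  have : (w i : ℂ) ≠ 0 := by exact_mod_cast hw i
  simp [mulWeight, this]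

theorem mulWeight_inv_mulWeight {ι : Type*} [Fintype ι] {w : ι → ℝ} (hw : ∀ i, w i ≠ 0)
    (a : EuclideanSpace ℂ ι) : mulWeight (fun i => (w i)⁻¹) (mulWeight w a) = a := by
  ext i
  have : (w i : ℂ) ≠ 0 := by exact_mod_cast hw i
  simp [mulWeight, this]

theorem antidiagCount_ne_zero (l : Fin (2 * N - 1)) : (antidiagCount N l : ℝ) ≠ 0 :=
  Nat.cast_ne_zero.mpr (antidiagCount_pos l).ne'

theorem inner_hankel_mulWeight_inv (a b : SeqSpace N) :
    inner ℂ (hankel N (mulWeight (fun l => (antidiagCount N l : ℝ)⁻¹) a)) (hankel N b) =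
      inner ℂ a b := by
  rw [inner_hankel_hankel, mulWeight_mulWeight_inv antidiagCount_ne_zero]

theorem hankelInv_hankel (a : SeqSpace N) : hankelInv N (hankel N a) = a := by
  have h : LinearMap.adjoint (hankel N) (hankel N a) =
      mulWeight (fun l => (antidiagCount N l : ℝ)) a := by
    refine ext_inner_right ℂ fun b => ?_
    rw [LinearMap.adjoint_inner_left, inner_hankel_hankel]
  rw [hankelInv, LinearMap.comp_apply, h, mulWeight_inv_mulWeight antidiagCount_ne_zero]

theorem hankel_injective : Function.Injective (hankel N) :=
  Function.LeftInverse.injective hankelInv_hankel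

theorem hankel_mem_hankelSpace (a : SeqSpace N) : hankel N a ∈ hankelSpace N :=
  LinearMap.mem_range_self _ _

end Hankel

/-! ### The objective functional and the fixed points -/

section Objective

variable {N J : ℕ} (IX : SeqSpace N →ₗ[ℂ] EuclideanSpace ℂ (Fin J)) (μ : Fin J → ℝ)
  (f : EuclideanSpace ℂ (Fin J)) (τ : ℝ)

/-- The back-projection `Λ β⁻¹ I_X* μ` of sampled data to Hankel matrices. -/
noncomputable def usBack : EuclideanSpace ℂ (Fin J) →ₗ[ℂ] MatSpace N :=
  hankel N ∘ₗ mulWeight (fun l => (antidiagCount N l : ℝ)⁻¹) ∘ₗ LinearMap.adjoint IX ∘ₗ mulWeight μ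

theorem usBack_mem_hankelSpace (x : EuclideanSpace ℂ (Fin J)) :
    usBack IX μ x ∈ hankelSpace N :=
  hankel_mem_hankelSpace _

theorem usOperator_eq_usBack (A : MatSpace N) :
    usOperator IX μ A = usBack IX μ (IX (hankelInv N A)) := rfl

theorem usOperator_hankel (a : SeqSpace N) : usOperator IX μ (hankel N a) = usBack IX μ (IX a) := by
  rw [usOperator_eq_usBack, hankelInv_hankel]

/-- Represents derivatives of the data term by Hankel matrices for the Frobenius product: the factor
`β⁻¹` cancels `Λ*Λ = β`. -/
theorem inner_usBack_hankel (x : EuclideanSpace ℂ (Fin J)) (b : SeqSpace N) :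
    inner ℂ (usBack IX μ x) (hankel N b) = inner ℂ (mulWeight μ x) (IX b) := by
  simp only [usBack, LinearMap.comp_apply]
  rw [inner_hankel_mulWeight_inv, LinearMap.adjoint_inner_left]

theorem re_inner_mulWeight_self (x : EuclideanSpace ℂ (Fin J)) :
    (inner ℂ (mulWeight μ x) x).re = ∑ j, μ j * ‖x j‖ ^ 2 := by
  rw [PiLp.inner_apply, Complex.re_sum]
  refine Finset.sum_congr rfl fun j _ => ?_
  change (inner ℂ ((μ j : ℂ) * x j) (x j)).re = _
  rw [← smul_eq_mul, inner_smul_left, Complex.conj_ofReal, Complex.re_ofReal_mul,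
    ← inner_self_eq_norm_sq (𝕜 := ℂ)]
  rfl

theorem inner_mulWeight_left (x y : EuclideanSpace ℂ (Fin J)) :
    inner ℂ (mulWeight μ x) y = inner ℂ x (mulWeight μ y) := by
  simp only [PiLp.inner_apply]
  refine Finset.sum_congr rfl fun j _ => ?_
  change inner ℂ ((μ j : ℂ) * x j) (y j) = inner ℂ (x j) ((μ j : ℂ) * y j)
  rw [← smul_eq_mul, ← smul_eq_mul, inner_smul_left, inner_smul_right, Complex.conj_ofReal]

theorem sum_mul_norm_add_sq (x y : EuclideanSpace ℂ (Fin J)) :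
    ∑ j, μ j * ‖(x + y) j‖ ^ 2 = ∑ j, μ j * ‖x j‖ ^ 2 +
      2 * (inner ℂ (mulWeight μ x) y).re + ∑ j, μ j * ‖y j‖ ^ 2 := by
  have h : (inner ℂ (mulWeight μ y) x).re = (inner ℂ (mulWeight μ x) y).re := by
    rw [inner_mulWeight_left, ← inner_conj_symm, Complex.conj_re]
  simp only [← re_inner_mulWeight_self]
  simp only [map_add, inner_add_left, inner_add_right, Complex.add_re]
  rw [h]; ring

theorem re_inner_usOperator_hankel (a : SeqSpace N) :
    (inner ℂ (usOperator IX μ (hankel N a)) (hankel N a)).re = ∑ j, μ j * ‖IX a j‖ ^ 2 := by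
  rw [usOperator_hankel, inner_usBack_hankel, re_inner_mulWeight_self]

theorem usObjective_eq (a : SeqSpace N) :
    usObjective IX μ f τ a = 2 * matEnv τ (hankel N a) +
      (∑ j, μ j * ‖(IX a - f) j‖ ^ 2 - ‖hankel N a‖ ^ 2) := by
  rw [usObjective, two_mul_matEnv]; ring

/-- The slope at `a` of the difference of the data term and `‖Λ a‖²`, up to a factor two. -/
noncomputable def usSlope (a : SeqSpace N) : SeqSpace N →ₗ[ℝ] ℝ :=
  reInner (usBack IX μ (IX a - f) - hankel N a) ∘ₗ (hankel N).restrictScalars ℝ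

theorem usSlope_apply (a h : SeqSpace N) :
    usSlope IX μ f a h = (inner ℂ (usBack IX μ (IX a - f) - hankel N a) (hankel N h)).re := rfl

/-- Outside `2G(Λ·)` the objective is a quadratic polynomial, so its expansion at `a` is exact. The
remainder is the form of `T - I` at `Λ(b - a)`. -/
theorem usObjective_sub (a b : SeqSpace N) :
    usObjective IX μ f τ b - usObjective IX μ f τ a -
      (2 * matEnv τ (hankel N b) - 2 * matEnv τ (hankel N a)) - 2 * usSlope IX μ f a (b - a) =
      ∑ j, μ j * ‖IX (b - a) j‖ ^ 2 - ‖hankel N (b - a)‖ ^ 2 := by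
  have h1 := sum_mul_norm_add_sq μ (IX a - f) (IX (b - a))
  rw [show IX a - f + IX (b - a) = IX b - f by rw [map_sub]; abel] at h1
  have h2 := norm_add_sq (𝕜 := ℂ) (hankel N a) (hankel N (b - a))
  rw [← map_add, add_sub_cancel] at h2
  change _ = _ + 2 * (inner ℂ (hankel N a) (hankel N (b - a))).re + _ at h2
  rw [usObjective_eq, usObjective_eq, usSlope_apply, inner_sub_left, Complex.sub_re,
    inner_usBack_hankel, h1, h2]
  ring

theorem exists_abs_le_mul_norm_sq : ∃ K : ℝ, ∀ h : SeqSpace N,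
    |∑ j, μ j * ‖IX h j‖ ^ 2 - ‖hankel N h‖ ^ 2| ≤ K * ‖h‖ ^ 2 := by
  set I := LinearMap.toContinuousLinearMap IX
  set L := LinearMap.toContinuousLinearMap (hankel N)
  refine ⟨∑ j, |μ j| * ‖I‖ ^ 2 + ‖L‖ ^ 2, fun h => ?_⟩
  have h1 : |∑ j, μ j * ‖IX h j‖ ^ 2| ≤ ∑ j, |μ j| * ‖I‖ ^ 2 * ‖h‖ ^ 2 := by
    refine (Finset.abs_sum_le_sum_abs _ _).trans (Finset.sum_le_sum fun j _ => ?_)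
    rw [abs_mul, abs_of_nonneg (sq_nonneg ‖IX h j‖), mul_assoc, ← mul_pow]
    have : ‖IX h j‖ ≤ ‖I‖ * ‖h‖ := (PiLp.norm_apply_le (IX h) j).trans (I.le_opNorm h)
    gcongr
  have h2 : |‖hankel N h‖ ^ 2| ≤ ‖L‖ ^ 2 * ‖h‖ ^ 2 := by
    rw [abs_of_nonneg (sq_nonneg _), ← mul_pow]
    have : ‖hankel N h‖ ≤ ‖L‖ * ‖h‖ := L.le_opNorm h
    gcongr
  rw [add_mul, Finset.sum_mul]
  exact (abs_sub _ _).trans (add_le_add h1 h2)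

theorem convexOn_matEnv : ConvexOn ℝ Set.univ (matEnv (N := N) τ) :=
  convexOn_of_exists_isSubgradient (exists_isSubgradient_matEnv τ)

/-- Stationarity of the objective in terms of the subgradients of the envelope. -/
theorem isStationaryPoint_usObjective_iff (a : SeqSpace N) :
    IsStationaryPoint (usObjective IX μ f τ) a ↔
      ∃ W, IsSubgradient (matEnv τ) (hankel N a) W ∧
        (hankelSpace N).starProjection W = hankel N a - usBack IX μ (IX a - f) := by
  have hconv : ConvexOn ℝ Set.univ (fun b => 2 * matEnv τ (hankel N b)) :=
    ((convexOn_matEnv τ).comp_linearMap ((hankel N).restrictScalars ℝ)).smul two_pos.le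
  obtain ⟨K, hK⟩ := exists_abs_le_mul_norm_sq IX μ
  rw [isStationaryPoint_iff_of_convexOn hconv ((2 : ℝ) • usSlope IX μ f a) (K := K) fun b => by
    rw [LinearMap.smul_apply, smul_eq_mul, usObjective_sub]; exact hK _]
  have hneg : ∀ h, (inner ℂ (hankel N a - usBack IX μ (IX a - f)) (hankel N h)).re =
      -usSlope IX μ f a h := fun h => by
    rw [usSlope_apply, ← Complex.neg_re, ← inner_neg_left, neg_sub]
  simp only [LinearMap.smul_apply, smul_eq_mul]
  constructor
  · intro hs
    refine exists_isSubgradient_starProjection_eq (convexOn_matEnv τ) (hankelSpace N)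
      (hankel_mem_hankelSpace a)
      (Submodule.sub_mem _ (hankel_mem_hankelSpace a) (usBack_mem_hankelSpace IX μ _)) ?_
    rintro _ ⟨b, rfl⟩
    rw [← map_sub, hneg]
    linarith [hs b]
  · rintro ⟨W, hW, hP⟩ b
    have h1 := hW (hankel N b)
    rw [← map_sub] at h1
    -- Only the component of `W` in `𝓗` is seen by Hankel directions.
    have h2 : inner ℂ W (hankel N (b - a)) =
        inner ℂ (hankel N a - usBack IX μ (IX a - f)) (hankel N (b - a)) := by
      rw [← hP, Submodule.inner_starProjection_left_eq_right,
        Submodule.starProjection_eq_self_iff.mpr (hankel_mem_hankelSpace _)]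
    rw [h2, hneg] at h1
    linarith

variable {τ}

theorem smul_usU {q : ℝ} (hq : q ≠ 0) (A : MatSpace N) :
    (q : ℂ) • usU IX μ q (usData IX μ f q) A =
      usBack IX μ f + (q : ℂ) • A - usOperator IX μ A := by
  have hq' : (q : ℂ) ≠ 0 := by exact_mod_cast hq
  have h1 : mulWeight (fun j => μ j / q) f = (q : ℂ)⁻¹ • mulWeight μ f := by
    ext j; simp [mulWeight]; ring
  have h2 : ∀ x : SeqSpace N, mulWeight (fun l => (q * (antidiagCount N l : ℝ))⁻¹) x =
      (q : ℂ)⁻¹ • mulWeight (fun l => (antidiagCount N l : ℝ)⁻¹) x := fun x => by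
    ext l; simp [mulWeight]; ring
  rw [usU, usData, h1, h2]
  simp only [map_smul, smul_sub, smul_add, smul_inv_smul₀ hq']
  rfl

/-- The second equation reads `P_𝓗 W = qU - (q-1)A`. Substituting it turns the thresholded argument
`qU + P_{𝓗^⊥} W` into `W + (q-1)A`, so the first equation becomes the subgradient condition. -/
theorem isFixedPt_usMap_iff (hτ : 0 ≤ τ) {q : ℝ} (hq : 1 < q) (W A : MatSpace N) :
    Function.IsFixedPt (usMap IX μ f τ q) (W, A) ↔
      A ∈ hankelSpace N ∧
        (hankelSpace N).starProjection W = A - (usOperator IX μ A - usBack IX μ f) ∧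
        IsSubgradient (matEnv τ) A W := by
  have hq1 : (q : ℂ) - 1 ≠ 0 := by exact_mod_cast (sub_pos.mpr hq).ne'
  rw [← eq_svCalc_iff_isSubgradient hτ hq]
  simp only [Function.IsFixedPt, usMap, Prod.mk.injEq, smul_usU IX μ f (by linarith : q ≠ 0),
    Submodule.starProjection_orthogonal_val, Complex.ofReal_sub, Complex.ofReal_one]
  set P := (hankelSpace N).starProjection with hP
  have harg : P W = A - (usOperator IX μ A - usBack IX μ f) →
      usBack IX μ f + (q : ℂ) • A - usOperator IX μ A + (W - P W) = W + ((q : ℂ) - 1) • A :=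
    fun h => by rw [h]; module
  constructor
  · rintro ⟨h1, h2⟩
    rw [h1, inv_smul_eq_iff₀ hq1] at h2
    have h3 : P W = A - (usOperator IX μ A - usBack IX μ f) := by
      rw [← sub_sub_cancel (usBack IX μ f + (q : ℂ) • A - usOperator IX μ A) (P W), h2]; module
    refine ⟨?_, h3, harg h3 ▸ h1⟩
    -- Every term on the right lies in `𝓗`, so a fixed point is automatically Hankel in its second
    -- component.
    rw [show A = P W + (usOperator IX μ A - usBack IX μ f) by rw [h3]; abel]
    exact Submodule.add_mem _ (Submodule.starProjection_apply_mem _ _)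
      (Submodule.sub_mem _ (usBack_mem_hankelSpace IX μ _) (usBack_mem_hankelSpace IX μ _))
  · rintro ⟨-, h3, h1⟩
    rw [harg h3, h1, h3, inv_smul_eq_iff₀ hq1]
    exact ⟨rfl, by module⟩

end Objective

/-! ### Fixed points, convexity and strict convexity -/

theorem corollary6p2 (N J : ℕ) (IX : SeqSpace N →ₗ[ℂ] EuclideanSpace ℂ (Fin J))
    (μ : Fin J → ℝ) (hμ : ∀ j, 0 < μ j) (f : EuclideanSpace ℂ (Fin J)) (τ : ℝ) (hτ : 0 < τ) :
    (∀ q : ℝ, 1 < q →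
      (∀ A ∈ hankelSpace N, (inner ℂ (usOperator IX μ A) A).re ≤ q * ‖A‖ ^ 2) →
      ∀ A : MatSpace N,
        (∃ W : MatSpace N, Function.IsFixedPt (usMap IX μ f τ q) (W, A)) ↔
          ∃ a : SeqSpace N, A = hankel N a ∧ IsStationaryPoint (usObjective IX μ f τ) a) ∧
    ((∀ A ∈ hankelSpace N, ‖A‖ ^ 2 ≤ (inner ℂ (usOperator IX μ A) A).re) →
      ConvexOn ℝ Set.univ (usObjective IX μ f τ)) ∧
    ((∀ A ∈ hankelSpace N, A ≠ 0 → ‖A‖ ^ 2 < (inner ℂ (usOperator IX μ A) A).re) →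
      StrictConvexOn ℝ Set.univ (usObjective IX μ f τ)) := by
  -- An affine support of `Φ` at `a`, up to the form of `T - I`. The slope joins a subgradient of
  -- `G` at `Λa` to the gradient of the quadratic part. The sign of the form then decides convexity
  -- or, as `Λ` is injective, strict convexity.
  have minorant : ∀ a, ∃ g : SeqSpace N →ₗ[ℝ] ℝ, ∀ b,
      usObjective IX μ f τ a + g (b - a) +
        ((inner ℂ (usOperator IX μ (hankel N (b - a))) (hankel N (b - a))).re -
          ‖hankel N (b - a)‖ ^ 2) ≤ usObjective IX μ f τ b := fun a => by
    obtain ⟨W, hW⟩ := exists_isSubgradient_matEnv τ (hankel N a)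
    refine ⟨(2 : ℝ) • (reInner W ∘ₗ (hankel N).restrictScalars ℝ + usSlope IX μ f a),
      fun b => ?_⟩
    have h1 := hW (hankel N b)
    rw [← map_sub] at h1
    have h2 := usObjective_sub IX μ f τ a b
    rw [re_inner_usOperator_hankel]
    change _ + 2 * ((inner ℂ W (hankel N (b - a))).re + usSlope IX μ f a (b - a)) + _ ≤ _
    linarith
  refine ⟨fun q hq _ A => ?_, fun hT => ?_, fun hT => ?_⟩
  · simp only [isFixedPt_usMap_iff IX μ f hτ.le hq, isStationaryPoint_usObjective_iff]
    constructor
    · rintro ⟨W, ⟨a, rfl⟩, hP, hW⟩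
      exact ⟨a, rfl, W, hW, by rw [hP, usOperator_hankel, map_sub]⟩
    · rintro ⟨a, rfl, W, hW, hP⟩
      exact ⟨W, hankel_mem_hankelSpace a, by rw [hP, usOperator_hankel, map_sub], hW⟩
  · refine convexOn_univ_of_exists_linear_le fun a => (minorant a).imp fun g hg b => ?_
    linarith [hg b, hT _ (hankel_mem_hankelSpace (b - a))]
  · refine strictConvexOn_univ_of_exists_linear_lt fun a => (minorant a).imp fun g hg b hb => ?_
    have hne : hankel N (b - a) ≠ 0 := fun h =>
      hb (sub_eq_zero.mp (hankel_injective (h.trans (map_zero _).symm)))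
    linarith [hg b, hT _ (hankel_mem_hankelSpace (b - a)) hne]
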